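/- Let $\mathcal L:\mathbb C[z]\to\mathbb C$ be a positive-definite linear functional, i.e. $\mathcal L[p]>0$ for every polynomial $p\not\equiv 0$ with $p(x)\ge 0$ for all real $x$. Let $\{P_n\}_{n\ge0}$ be the monic orthogonal polynomial system of $\mathcal L$: $P_n$ is monic of degree $n$, $\mathcal L[P_nP_m]=0$ for $n\ne m$, and $\mathcal L[P_n^2]\neq0$. Then $P_0=1$, $P_1(z)=z-c_1$ and $zP_n(z)=P_{n+1}(z)+c_{n+1}P_n(z)+\lambda_{n+1}P_{n-1}(z)$ for $n\ge1$, with uniquely determined coefficients. Suppose that $\{P_n\}$ is in the Nevai class $\mathcal N(a,c)$, i.e. $c_n\to c$ and $\lambda_n\to a$ for some $c\in\mathbb R$ and $a\in[0,\infty)$. Let $\kappa\in\mathbb C\setminus\mathbb R$ and let $$P^*_n(\kappa,z)=\frac{1}{z-\kappa}\left[P_{n+1}(z)-\frac{P_{n+1}(\kappa)}{P_n(\kappa)}P_n(z)\right],\qquad n\ge0,$$ be the kernel polynomials (here $P_n(\kappa)\ne0$ for every $n$, and $P_n^*(\kappa,\cdot)$ is a polynomial). Then the imaginary parts of the zeros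 of $P^*_n(\kappa,z)$ tend to zero as $n\to\infty$, uniformly over the zeros: for every $\varepsilon>0$ there is $N$ such that for all $n\ge N$ every zero $z\in\mathbb C$ of $P^*_n(\kappa,\cdot)$ satisfies $|\operatorname{Im} z|<\varepsilon$. -/

import Mathlib

open Polynomial Filter Topology
open scoped ComplexOrder

/-- A linear functional on complex polynomials is positive-definite if it takes a positive real
value at every nonzero polynomial that is (real and) nonnegative at all real points.
On `ℂ`, the order used here is `z ≤ w ↔ z.re ≤ w.re ∧ z.im = w.im`. -/
def IsPositiveDefinite (L : ℂ[X] →ₗ[ℂ] ℂ) : Prop :=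
  ∀ p : ℂ[X], p ≠ 0 → (∀ x : ℝ, 0 ≤ p.eval (x : ℂ)) → 0 < L p

/-- `P` is a monic orthogonal polynomial system with respect to `L`. -/
structure IsMonicOPS (L : ℂ[X] →ₗ[ℂ] ℂ) (P : ℕ → ℂ[X]) : Prop where
  monic : ∀ n, (P n).Monic
  natDegree_eq : ∀ n, (P n).natDegree = n
  orthogonal : ∀ n m, n ≠ m → L (P n * P m) = 0
  norm_ne_zero : ∀ n, L (P n ^ 2) ≠ 0

/-- `b n`, `l n` are the entries `c_n`, `λ_n` of the three-term recurrence
`z P_n = P_{n+1} + c_{n+1} P_n + λ_{n+1} P_{n-1}` (`n ≥ 1`), `P_0 = 1`, `P_1 = z - c_1`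
(the values `b 0`, `l 0`, `l 1` are irrelevant). -/
structure IsRecurrenceCoeffs (P : ℕ → ℂ[X]) (b l : ℕ → ℂ) : Prop where
  zero : P 0 = 1
  one : P 1 = X - C (b 1)
  rec_eq : ∀ n, 1 ≤ n → X * P n = P (n + 1) + C (b (n + 1)) * P n + C (l (n + 1)) * P (n - 1)

/-- The Nevai class `N(a, c)`: the recurrence coefficients satisfy `c_n → c`, `λ_n → a`,
where `c ∈ ℝ` and `a ∈ [0, ∞)`. -/
def InNevaiClass (P : ℕ → ℂ[X]) (a c : ℝ) : Prop :=
  0 ≤ a ∧ ∃ b l : ℕ → ℂ, IsRecurrenceCoeffs P b l ∧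
    Tendsto b atTop (𝓝 (c : ℂ)) ∧ Tendsto l atTop (𝓝 (a : ℂ))

/-- The kernel polynomial
`P*_n(κ, z) = (z - κ)⁻¹ (P_{n+1}(z) - (P_{n+1}(κ) / P_n(κ)) P_n(z))`, as a polynomial in `z`. -/
noncomputable def kernelPoly (P : ℕ → ℂ[X]) (κ : ℂ) (n : ℕ) : ℂ[X] :=
  (P (n + 1) - C ((P (n + 1)).eval κ / (P n).eval κ) * P n) /ₘ (X - C κ)

/-- The division defining `kernelPoly` is exact. -/
theorem X_sub_C_mul_kernelPoly (P : ℕ → ℂ[X]) (κ : ℂ) (n : ℕ) (h : (P n).eval κ ≠ 0) :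
    (X - C κ) * kernelPoly P κ n =
      P (n + 1) - C ((P (n + 1)).eval κ / (P n).eval κ) * P n := by
  unfold kernelPoly
  rw [mul_divByMonic_eq_iff_isRoot]
  simp [IsRoot, h]

/-!
Write `r n = P (n + 1) / P n`, evaluated at a point `z` off the real axis. The three-term recurrence
becomes `r (n + 1) = z - β (n + 1) - Λ n / r n` with real `β` and positive `Λ`, and the quotient
`S n = kernelPoly P κ n / P n` at `z` satisfies `S 0 = 1`, `S (n + 1) = 1 + t n * S n` with
`t n = Λ n / (r n (z) * r n (κ))` (`eval_kernelPoly_eq`). The claim is that `S n ≠ 0` for all large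
`n`, uniformly in `|Im z| ≥ ε`.

The tool is the height `T n = Im (r n) / Im z`, which satisfies `T (n + 1) = 1 + (Λ n / |r n|²) T n`
and `1 ≤ T n ≤ B` with `B` depending only on `ε` and on a bound for `Λ`. Hence
`√(Λ n) / |r n| ≤ √(1 - 1/B) * √(T (n + 1) / T n)` (`stepFactor_mul_sqrt_height_le`): after
reweighting by `√(T n)`, the linearised recursions for `r` and for `S` are contractions with a
uniform ratio (`exists_majorant_of_weighted_contraction`). As `β` and `Λ` converge, this shows
that `r (n + 1) - r n → 0` uniformly, then that `t (n + 1) - t n → 0` uniformly, and then that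
`S (n + 1) - S n → 0` uniformly. If `S (n + 1) = 0`, then `S n` is small, and `0 = 1 + t n * S n` is
absurd because `t` is bounded. No knowledge of the limit of `r n` is needed.
-/

/-! ### Perturbed contractions -/

/-- The solution of `m (n + 1) = θ * m n + η n` with `m 0 = C`. -/
noncomputable def contractionMajorant (θ C : ℝ) (η : ℕ → ℝ) : ℕ → ℝ
  | 0 => C
  | n + 1 => θ * contractionMajorant θ C η n + η n

lemma tendsto_contractionMajorant {θ : ℝ} (C : ℝ) {η : ℕ → ℝ} (h0 : 0 ≤ θ) (h1 : θ < 1)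
    (hη : Tendsto η atTop (𝓝 0)) : Tendsto (contractionMajorant θ C η) atTop (𝓝 0) := by
  set m := contractionMajorant θ C η with hm
  rw [Metric.tendsto_atTop]
  intro δ hδ
  have hpos : 0 < δ / 2 * (1 - θ) := by nlinarith
  obtain ⟨N, hN⟩ := Metric.tendsto_atTop.1 hη _ hpos
  have hk : ∀ k, |m (N + k)| ≤ θ ^ k * |m N| + δ / 2 := by
    intro k
    induction k with
    | zero => simp; linarith
    | succ k ih =>
      have h2 : m (N + (k + 1)) = θ * m (N + k) + η (N + k) := rfl
      have h3 := hN (N + k) (by omega)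
      rw [Real.dist_eq, sub_zero] at h3
      calc |m (N + (k + 1))| ≤ θ * |m (N + k)| + |η (N + k)| := by
            rw [h2]
            exact (abs_add_le _ _).trans (by rw [abs_mul, abs_of_nonneg h0])
        _ ≤ θ * (θ ^ k * |m N| + δ / 2) + δ / 2 * (1 - θ) := by gcongr
        _ = _ := by ring
  have hlim : Tendsto (fun k : ℕ => θ ^ k * |m N|) atTop (𝓝 0) := by
    simpa using (tendsto_pow_atTop_nhds_zero_of_lt_one h0 h1).mul_const |m N|
  obtain ⟨K, hK⟩ := Metric.tendsto_atTop.1 hlim (δ / 2) (by linarith)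
  refine ⟨N + K, fun n hn => ?_⟩
  obtain ⟨k, rfl⟩ := Nat.exists_eq_add_of_le (show N ≤ n by omega)
  have h4 := hK k (by omega)
  rw [Real.dist_eq, sub_zero] at h4
  rw [Real.dist_eq, sub_zero]
  linarith [hk k, le_abs_self (θ ^ k * |m N|)]

/-- A perturbed linear recursion whose factors contract after reweighting by weights in `[1, B]`
has its solutions dominated by a null sequence that depends only on the constants and on the
perturbation. This is the source of all uniformity in the argument. -/
lemma exists_majorant_of_weighted_contraction {θ B C : ℝ} {η : ℕ → ℝ} (h0 : 0 ≤ θ) (h1 : θ < 1)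
    (hη : Tendsto η atTop (𝓝 0)) :
    ∃ m : ℕ → ℝ, Tendsto m atTop (𝓝 0) ∧
      ∀ e q w : ℕ → ℝ, (∀ n, 0 ≤ e n) → e 0 ≤ C → (∀ n, 1 ≤ w n) → (∀ n, w n ≤ B) →
        (∀ n, q n * w n ≤ θ * w (n + 1)) → (∀ n, e (n + 1) ≤ q n * e n + η n) →
        ∀ n, e n ≤ m n := by
  have hη' : Tendsto (fun n => |η n|) atTop (𝓝 0) := by simpa using hη.abs
  refine ⟨fun n => B * contractionMajorant θ C (fun n => |η n|) n, ?_, ?_⟩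
  · simpa using (tendsto_contractionMajorant C h0 h1 hη').const_mul B
  intro e q w he hC hw hwB hq hrec n
  have key : ∀ n, e n ≤ w n * contractionMajorant θ C (fun n => |η n|) n := by
    intro n
    induction n with
    | zero =>
      change e 0 ≤ w 0 * C
      nlinarith [he 0, hw 0]
    | succ n ih =>
      change e (n + 1) ≤ w (n + 1) * (θ * contractionMajorant θ C (fun n => |η n|) n + |η n|)
      set m := contractionMajorant θ C (fun n => |η n|) n
      have hwn : 0 < w n := by linarith [hw n]
      have hm : 0 ≤ m := nonneg_of_mul_nonneg_right ((he n).trans ih) hwn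
      have h2 : |η n| ≤ w (n + 1) * |η n| := le_mul_of_one_le_left (abs_nonneg _) (hw _)
      -- The factor `q n` may be negative, in which case the term `q n * e n` is dropped.
      have h3 : q n * e n ≤ w (n + 1) * (θ * m) := by
        rcases le_total 0 (q n) with h | h
        · calc q n * e n ≤ q n * (w n * m) := by gcongr
            _ = (q n * w n) * m := by ring
            _ ≤ (θ * w (n + 1)) * m := mul_le_mul_of_nonneg_right (hq n) hm
            _ = _ := by ring
        · have : 0 ≤ w (n + 1) := by linarith [hw (n + 1)]
          exact (mul_nonpos_of_nonpos_of_nonneg h (he n)).trans (by positivity)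
      linarith [hrec n, le_abs_self (η n)]
  have hm : 0 ≤ contractionMajorant θ C (fun n => |η n|) n :=
    nonneg_of_mul_nonneg_right ((he n).trans (key n)) (by linarith [hw n])
  exact (key n).trans (mul_le_mul_of_nonneg_right (hwB n) hm)

/-! ### Ratios of consecutive orthogonal polynomials -/

/-- The ratios `P (n + 1) / P n` at `z` of the monic polynomials with diagonal recurrence
coefficients `β 0, β 1, …` and off-diagonal ones `Λ 0, Λ 1, …`, defined through the Riccati form of
the three-term recurrence. -/
noncomputable def jacobiRatio (β Λ : ℕ → ℝ) (z : ℂ) : ℕ → ℂ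
  | 0 => z - β 0
  | n + 1 => z - β (n + 1) - Λ n / jacobiRatio β Λ z n

/-- The ratio by which `jacobiRatio` expands imaginary parts. For orthonormal polynomials `p k` it is
the Christoffel–Darboux sum `∑ k ≤ n, |p k z|²` divided by `|p n z|²`. -/
noncomputable def jacobiHeight (β Λ : ℕ → ℝ) (z : ℂ) (n : ℕ) : ℝ :=
  (jacobiRatio β Λ z n).im / z.im

/-- The square root of the factor by which one step of the recursion multiplies heights. -/
noncomputable def stepFactor (β Λ : ℕ → ℝ) (z : ℂ) (n : ℕ) : ℝ :=
  √(Λ n) / ‖jacobiRatio β Λ z n‖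

section Ratio

variable {β Λ : ℕ → ℝ} {z : ℂ}

lemma jacobiHeight_zero (hz : z.im ≠ 0) : jacobiHeight β Λ z 0 = 1 := by
  simp [jacobiHeight, jacobiRatio, hz]

lemma im_ofReal_div (x : ℝ) (w : ℂ) : ((x : ℂ) / w).im = -(x * w.im / ‖w‖ ^ 2) := by
  rw [Complex.div_im, ← Complex.normSq_eq_norm_sq]
  simp

lemma jacobiHeight_succ (hΛ : ∀ n, 0 ≤ Λ n) (hz : z.im ≠ 0) (n : ℕ) :
    jacobiHeight β Λ z (n + 1) = 1 + stepFactor β Λ z n ^ 2 * jacobiHeight β Λ z n := by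
  rw [jacobiHeight, jacobiRatio, Complex.sub_im, im_ofReal_div, stepFactor, div_pow,
    Real.sq_sqrt (hΛ n), jacobiHeight]
  simp only [Complex.sub_im, Complex.ofReal_im]
  field_simp
  ring

lemma one_le_jacobiHeight (hΛ : ∀ n, 0 ≤ Λ n) (hz : z.im ≠ 0) (n : ℕ) :
    1 ≤ jacobiHeight β Λ z n := by
  induction n with
  | zero => rw [jacobiHeight_zero hz]
  | succ n ih =>
    rw [jacobiHeight_succ hΛ hz]
    have : 0 ≤ stepFactor β Λ z n ^ 2 * jacobiHeight β Λ z n := by positivity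
    linarith

lemma abs_im_le_norm_jacobiRatio (hΛ : ∀ n, 0 ≤ Λ n) (hz : z.im ≠ 0) (n : ℕ) :
    |z.im| ≤ ‖jacobiRatio β Λ z n‖ := by
  refine le_trans ?_ (Complex.abs_im_le_norm _)
  have h := one_le_jacobiHeight (β := β) hΛ hz n
  have h2 : (jacobiRatio β Λ z n).im = jacobiHeight β Λ z n * z.im := by
    rw [jacobiHeight]; field_simp
  rw [h2, abs_mul]
  exact le_mul_of_one_le_left (abs_nonneg _) (h.trans (le_abs_self _))

lemma jacobiRatio_ne_zero (hΛ : ∀ n, 0 ≤ Λ n) (hz : z.im ≠ 0) (n : ℕ) :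
    jacobiRatio β Λ z n ≠ 0 :=
  norm_pos_iff.1 ((abs_pos.2 hz).trans_le (abs_im_le_norm_jacobiRatio hΛ hz n))

variable {M ε : ℝ}

lemma norm_div_jacobiRatio_le (hΛ : ∀ n, 0 ≤ Λ n) (hM : ∀ n, Λ n ≤ M) (hε : 0 < ε)
    (hz : ε ≤ |z.im|) (n k : ℕ) : ‖(Λ k : ℂ) / jacobiRatio β Λ z n‖ ≤ M / ε := by
  have hz' : z.im ≠ 0 := abs_pos.1 (hε.trans_le hz)
  have h := hz.trans (abs_im_le_norm_jacobiRatio (β := β) hΛ hz' n)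
  rw [norm_div, Complex.norm_real, Real.norm_of_nonneg (hΛ k)]
  exact div_le_div₀ ((hΛ k).trans (hM k)) (hM k) hε h

/-- Heights are bounded uniformly in `z` on `|Im z| ≥ ε`, even though the ratios are not. -/
lemma jacobiHeight_le (hΛ : ∀ n, 0 ≤ Λ n) (hM : ∀ n, Λ n ≤ M) (hε : 0 < ε)
    (hz : ε ≤ |z.im|) (n : ℕ) : jacobiHeight β Λ z n ≤ 1 + M / ε ^ 2 := by
  have hz' : z.im ≠ 0 := abs_pos.1 (hε.trans_le hz)
  have hM0 : 0 ≤ M := (hΛ 0).trans (hM 0)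
  cases n with
  | zero =>
    rw [jacobiHeight_zero hz']
    have : 0 ≤ M / ε ^ 2 := by positivity
    linarith
  | succ n =>
    have h1 : jacobiHeight β Λ z (n + 1) = 1 - ((Λ n : ℂ) / jacobiRatio β Λ z n).im / z.im := by
      rw [jacobiHeight, jacobiRatio]
      simp only [Complex.sub_im, Complex.ofReal_im, sub_zero]
      field_simp
    have h2 : |((Λ n : ℂ) / jacobiRatio β Λ z n).im / z.im| ≤ M / ε / ε := by
      rw [abs_div]
      exact div_le_div₀ (by positivity) ((Complex.abs_im_le_norm _).trans
        (norm_div_jacobiRatio_le hΛ hM hε hz n n)) hε hz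
    have h3 : M / ε / ε = M / ε ^ 2 := by rw [div_div, sq]
    rw [h1, ← h3]
    linarith [neg_abs_le (((Λ n : ℂ) / jacobiRatio β Λ z n).im / z.im)]

lemma stepFactor_nonneg (n : ℕ) : 0 ≤ stepFactor β Λ z n := by
  unfold stepFactor; positivity

/-- The basic contraction: since `T (n + 1) - 1 ≤ (1 - 1/B) T (n + 1)` for heights bounded by `B`,
one step contracts once quantities are measured relative to `√(T n)`. -/
lemma stepFactor_mul_sqrt_height_le {B : ℝ} (hΛ : ∀ n, 0 ≤ Λ n) (hz : z.im ≠ 0)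
    (hB : ∀ n, jacobiHeight β Λ z n ≤ B) (n : ℕ) :
    stepFactor β Λ z n * √(jacobiHeight β Λ z n) ≤
      √(1 - 1 / B) * √(jacobiHeight β Λ z (n + 1)) := by
  have h1 := one_le_jacobiHeight (β := β) hΛ hz
  have hB1 : 1 ≤ B := (h1 0).trans (hB 0)
  have hθ : 0 ≤ 1 - 1 / B := by
    have := (div_le_one (by linarith)).2 hB1
    linarith
  rw [← Real.sqrt_mul hθ]
  refine Real.le_sqrt_of_sq_le ?_
  rw [mul_pow, Real.sq_sqrt (by linarith [h1 n])]
  have h2 := jacobiHeight_succ (β := β) hΛ hz n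
  have h3 : jacobiHeight β Λ z (n + 1) / B ≤ 1 := (div_le_one (by linarith)).2 (hB _)
  have h4 : (1 - 1 / B) * jacobiHeight β Λ z (n + 1)
      = jacobiHeight β Λ z (n + 1) - jacobiHeight β Λ z (n + 1) / B := by ring
  linarith

lemma jacobiRatio_succ_sub_succ (hΛ : ∀ n, 0 ≤ Λ n) (hz : z.im ≠ 0) (n : ℕ) :
    jacobiRatio β Λ z (n + 2) - jacobiRatio β Λ z (n + 1) =
      Λ (n + 1) / (jacobiRatio β Λ z (n + 1) * jacobiRatio β Λ z n) *
        (jacobiRatio β Λ z (n + 1) - jacobiRatio β Λ z n) +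
      ((β (n + 1) - β (n + 2) : ℝ) + ((Λ n - Λ (n + 1) : ℝ) : ℂ) / jacobiRatio β Λ z n) := by
  have h0 := jacobiRatio_ne_zero (β := β) hΛ hz n
  have h1 := jacobiRatio_ne_zero (β := β) hΛ hz (n + 1)
  have e1 : jacobiRatio β Λ z (n + 1) = z - β (n + 1) - Λ n / jacobiRatio β Λ z n := rfl
  have e2 : jacobiRatio β Λ z (n + 2) = z - β (n + 2) - Λ (n + 1) / jacobiRatio β Λ z (n + 1) := rfl
  have e3 : jacobiRatio β Λ z (n + 2) - jacobiRatio β Λ z (n + 1) =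
      (β (n + 1) - β (n + 2)) + Λ n / jacobiRatio β Λ z n
        - Λ (n + 1) / jacobiRatio β Λ z (n + 1) := by
    rw [e2]; nth_rewrite 2 [e1]; ring
  rw [e3]
  generalize jacobiRatio β Λ z (n + 1) = s at *
  push_cast
  field_simp
  ring

lemma norm_jacobiRatio_succ_sub_le {R : ℝ} (hΛ : ∀ n, 0 ≤ Λ n) (hM : ∀ n, Λ n ≤ M)
    (hR : ∀ n, |β n| ≤ R) (hε : 0 < ε) (hz : ε ≤ |z.im|) (n : ℕ) :
    ‖jacobiRatio β Λ z (n + 1) - jacobiRatio β Λ z n‖ ≤ 2 * R + 2 * (M / ε) := by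
  have hM0 : 0 ≤ M / ε := div_nonneg ((hΛ 0).trans (hM 0)) hε.le
  have h : ∀ k, ‖jacobiRatio β Λ z k - z‖ ≤ R + M / ε := by
    intro k
    cases k with
    | zero =>
      have : jacobiRatio β Λ z 0 - z = -(β 0 : ℂ) := by simp [jacobiRatio]
      rw [this, norm_neg, Complex.norm_real, Real.norm_eq_abs]
      linarith [hR 0]
    | succ k =>
      have : jacobiRatio β Λ z (k + 1) - z = -(β (k + 1) : ℂ) - Λ k / jacobiRatio β Λ z k := by
        rw [jacobiRatio]; ring
      rw [this]
      refine (norm_sub_le _ _).trans ?_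
      rw [norm_neg, Complex.norm_real, Real.norm_eq_abs]
      exact add_le_add (hR _) (norm_div_jacobiRatio_le hΛ hM hε hz k k)
  calc ‖jacobiRatio β Λ z (n + 1) - jacobiRatio β Λ z n‖
      = ‖(jacobiRatio β Λ z (n + 1) - z) - (jacobiRatio β Λ z n - z)‖ := by congr 1; ring
    _ ≤ _ := norm_sub_le _ _
    _ ≤ _ := by linarith [h (n + 1), h n]

end Ratio

section Uniform

variable {β Λ : ℕ → ℝ} {M R ε : ℝ}

lemma sqrt_mul_sqrt_le {x y B : ℝ} (hx : x ≤ B) (hy : y ≤ B) (hB : 0 ≤ B) : √x * √y ≤ B :=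
  calc √x * √y ≤ √B * √B := by gcongr
    _ = B := Real.mul_self_sqrt hB

lemma one_le_sqrt_mul_sqrt {x y : ℝ} (hx : 1 ≤ x) (hy : 1 ≤ y) : 1 ≤ √x * √y :=
  one_le_mul_of_one_le_of_one_le (Real.one_le_sqrt.2 hx) (Real.one_le_sqrt.2 hy)

lemma mul_mul_sqrt_mul_sqrt_le {θ p q x x' y y' : ℝ} (hθ : 0 ≤ θ) (hq : 0 ≤ q)
    (h1 : p * √x ≤ √θ * √x') (h2 : q * √y ≤ √θ * √y') :
    p * q * (√x * √y) ≤ θ * (√x' * √y') :=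
  calc p * q * (√x * √y) = (p * √x) * (q * √y) := by ring
    _ ≤ (√θ * √x') * (√θ * √y') :=
        mul_le_mul h1 h2 (by positivity) (by positivity)
    _ = (√θ * √θ) * (√x' * √y') := by ring
    _ = _ := by rw [Real.mul_self_sqrt hθ]

lemma exists_uniform_majorant_jacobiRatio_sub {b l : ℝ} (hΛ : ∀ n, 0 ≤ Λ n) (hM : ∀ n, Λ n ≤ M)
    (hR : ∀ n, |β n| ≤ R) (hε : 0 < ε) (hβ : Tendsto β atTop (𝓝 b)) (hl : Tendsto Λ atTop (𝓝 l)) :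
    ∃ m : ℕ → ℝ, Tendsto m atTop (𝓝 0) ∧ ∀ z : ℂ, ε ≤ |z.im| → ∀ n,
      ‖jacobiRatio β Λ z (n + 1) - jacobiRatio β Λ z n‖ ≤ m n := by
  have hM0 : 0 ≤ M := (hΛ 0).trans (hM 0)
  set B := 1 + M / ε ^ 2 with hBdef
  have hB1 : 1 ≤ B := by
    have : 0 ≤ M / ε ^ 2 := by positivity
    linarith
  have hθ0 : 0 ≤ 1 - 1 / B := by
    have := (div_le_one (by linarith)).2 hB1
    linarith
  have hθ1 : 1 - 1 / B < 1 := by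
    have : 0 < 1 / B := by positivity
    linarith
  set D := 2 * R + 2 * (M / ε) with hD
  -- Replacing `Λ (n + 1)` by the geometric mean `√(Λ (n + 1)) * √(Λ n)` turns the factor of the
  -- linearised recursion into a product of two step factors; the cost is the last term of `η`.
  set η : ℕ → ℝ := fun n => |β (n + 1) - β (n + 2)| + |Λ n - Λ (n + 1)| / ε
    + |Λ (n + 1) - √(Λ (n + 1)) * √(Λ n)| / ε ^ 2 * D with hη
  have hηlim : Tendsto η atTop (𝓝 0) := by
    have b1 := (tendsto_add_atTop_iff_nat 1).2 hβ
    have b2 := (tendsto_add_atTop_iff_nat 2).2 hβ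
    have l1 := (tendsto_add_atTop_iff_nat 1).2 hl
    have hl0 : 0 ≤ l := ge_of_tendsto' hl hΛ
    have := (((b1.sub b2).abs).add (((hl.sub l1).abs).div_const ε)).add
      (((l1.sub (l1.sqrt.mul hl.sqrt)).abs.div_const (ε ^ 2)).mul_const D)
    simpa [Real.mul_self_sqrt hl0] using this
  obtain ⟨m, hm, hmaj⟩ := exists_majorant_of_weighted_contraction (B := B) (C := D) hθ0 hθ1 hηlim
  refine ⟨m, hm, fun z hz => ?_⟩
  have hz' : z.im ≠ 0 := abs_pos.1 (hε.trans_le hz)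
  have hT1 := one_le_jacobiHeight (β := β) hΛ hz'
  have hTB := jacobiHeight_le (β := β) hΛ hM hε hz
  have hstep := stepFactor_mul_sqrt_height_le (β := β) hΛ hz' hTB
  refine hmaj _ (fun n => stepFactor β Λ z (n + 1) * stepFactor β Λ z n)
    (fun n => √(jacobiHeight β Λ z (n + 1)) * √(jacobiHeight β Λ z n)) (fun n => norm_nonneg _)
    (norm_jacobiRatio_succ_sub_le hΛ hM hR hε hz 0)
    (fun n => one_le_sqrt_mul_sqrt (hT1 _) (hT1 _))
    (fun n => sqrt_mul_sqrt_le (hTB _) (hTB _) (by linarith))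
    (fun n => mul_mul_sqrt_mul_sqrt_le hθ0 (stepFactor_nonneg n) (hstep _) (hstep _)) (fun n => ?_)
  have hr0 := hz.trans (abs_im_le_norm_jacobiRatio (β := β) hΛ hz' n)
  have hr1 := hz.trans (abs_im_le_norm_jacobiRatio (β := β) hΛ hz' (n + 1))
  have hd := norm_jacobiRatio_succ_sub_le (β := β) hΛ hM hR hε hz n
  rw [jacobiRatio_succ_sub_succ hΛ hz' n]
  set d := ‖jacobiRatio β Λ z (n + 1) - jacobiRatio β Λ z n‖ with hd'
  have hd0 : 0 ≤ d := norm_nonneg _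
  have e1 : ‖(Λ (n + 1) : ℂ) / (jacobiRatio β Λ z (n + 1) * jacobiRatio β Λ z n) *
      (jacobiRatio β Λ z (n + 1) - jacobiRatio β Λ z n)‖ ≤
      stepFactor β Λ z (n + 1) * stepFactor β Λ z n * d +
        |Λ (n + 1) - √(Λ (n + 1)) * √(Λ n)| / ε ^ 2 * D := by
    rw [norm_mul, norm_div, norm_mul, Complex.norm_real, Real.norm_of_nonneg (hΛ _), ← hd',
      stepFactor, stepFactor, div_mul_div_comm]
    set ρ := ‖jacobiRatio β Λ z (n + 1)‖ * ‖jacobiRatio β Λ z n‖ with hρ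
    have hρε : ε ^ 2 ≤ ρ := by rw [sq]; exact mul_le_mul hr1 hr0 hε.le (norm_nonneg _)
    have h5 : Λ (n + 1) / ρ * d = √(Λ (n + 1)) * √(Λ n) / ρ * d
        + (Λ (n + 1) - √(Λ (n + 1)) * √(Λ n)) / ρ * d := by ring
    have h6 : (Λ (n + 1) - √(Λ (n + 1)) * √(Λ n)) / ρ * d ≤
        |Λ (n + 1) - √(Λ (n + 1)) * √(Λ n)| / ε ^ 2 * D := by
      have hρ0 : 0 < ρ := lt_of_lt_of_le (by positivity) hρε
      calc _ ≤ |Λ (n + 1) - √(Λ (n + 1)) * √(Λ n)| / ρ * d := by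
            gcongr; exact le_abs_self _
        _ ≤ _ := by gcongr
    linarith
  have e2 : ‖((β (n + 1) - β (n + 2) : ℝ) : ℂ) +
      ((Λ n - Λ (n + 1) : ℝ) : ℂ) / jacobiRatio β Λ z n‖ ≤
      |β (n + 1) - β (n + 2)| + |Λ n - Λ (n + 1)| / ε := by
    refine (norm_add_le _ _).trans ?_
    rw [norm_div, Complex.norm_real, Complex.norm_real, Real.norm_eq_abs, Real.norm_eq_abs]
    gcongr
  refine (norm_add_le _ _).trans ?_
  simp only [hη]
  linarith

/-! ### The quotient of the kernel polynomial by the orthogonal polynomial -/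

/-- The coefficient `t n` of the recursion satisfied by `kernelPoly P κ n / P n`. -/
noncomputable def kernelStep (β Λ : ℕ → ℝ) (κ z : ℂ) (n : ℕ) : ℂ :=
  Λ n / (jacobiRatio β Λ z n * jacobiRatio β Λ κ n)

/-- The quotient `kernelPoly P κ n / P n` at `z`, defined through its recursion. -/
noncomputable def kernelRatio (β Λ : ℕ → ℝ) (κ z : ℂ) : ℕ → ℂ
  | 0 => 1
  | n + 1 => 1 + kernelStep β Λ κ z n * kernelRatio β Λ κ z n

lemma norm_kernelStep (hΛ : ∀ n, 0 ≤ Λ n) (κ z : ℂ) (n : ℕ) :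
    ‖kernelStep β Λ κ z n‖ = stepFactor β Λ z n * stepFactor β Λ κ n := by
  rw [kernelStep, stepFactor, stepFactor, div_mul_div_comm, Real.mul_self_sqrt (hΛ n), norm_div,
    norm_mul, Complex.norm_real, Real.norm_of_nonneg (hΛ n)]

/-- The Cauchy–Schwarz inequality for Christoffel–Darboux sums, proved along the recursion. -/
lemma norm_kernelRatio_le {κ z : ℂ} (hΛ : ∀ n, 0 ≤ Λ n) (hz : z.im ≠ 0) (hκ : κ.im ≠ 0) (n : ℕ) :
    ‖kernelRatio β Λ κ z n‖ ≤ √(jacobiHeight β Λ z n) * √(jacobiHeight β Λ κ n) := by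
  induction n with
  | zero => simp [kernelRatio, jacobiHeight_zero, hz, hκ]
  | succ n ih =>
    have h1 := one_le_jacobiHeight (β := β) hΛ hz n
    have h2 := one_le_jacobiHeight (β := β) hΛ hκ n
    rw [kernelRatio]
    set p := stepFactor β Λ z n * √(jacobiHeight β Λ z n) with hp
    set q := stepFactor β Λ κ n * √(jacobiHeight β Λ κ n) with hq
    have hp2 : jacobiHeight β Λ z (n + 1) = 1 + p ^ 2 := by
      rw [jacobiHeight_succ hΛ hz, hp, mul_pow, Real.sq_sqrt (by linarith)]
    have hq2 : jacobiHeight β Λ κ (n + 1) = 1 + q ^ 2 := by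
      rw [jacobiHeight_succ hΛ hκ, hq, mul_pow, Real.sq_sqrt (by linarith)]
    have h3 : ‖kernelStep β Λ κ z n * kernelRatio β Λ κ z n‖ ≤ p * q := by
      rw [norm_mul, norm_kernelStep hΛ]
      calc _ ≤ stepFactor β Λ z n * stepFactor β Λ κ n *
            (√(jacobiHeight β Λ z n) * √(jacobiHeight β Λ κ n)) :=
            mul_le_mul_of_nonneg_left ih (mul_nonneg (stepFactor_nonneg n) (stepFactor_nonneg n))
        _ = _ := by rw [hp, hq]; ring
    have h4 : ‖1 + kernelStep β Λ κ z n * kernelRatio β Λ κ z n‖ ≤ 1 + p * q := by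
      refine (norm_add_le _ _).trans ?_
      rw [norm_one]
      linarith
    refine h4.trans ?_
    rw [hp2, hq2, ← Real.sqrt_mul (by positivity)]
    refine Real.le_sqrt_of_sq_le ?_
    nlinarith [sq_nonneg (p - q)]

lemma norm_inv_mul_sub_inv_mul_le {u u' v v' : ℂ} {s : ℝ} (hε : 0 < ε) (hu : ε ≤ ‖u‖)
    (hu' : ε ≤ ‖u'‖) (hv : ε ≤ ‖v‖) (hv' : ε ≤ ‖v'‖) (hs : ‖u' - u‖ ≤ s) (ht : ‖v' - v‖ ≤ s) :
    ‖(u' * v')⁻¹ - (u * v)⁻¹‖ ≤ 2 * s / ε ^ 3 := by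
  have n1 : u ≠ 0 := norm_pos_iff.1 (hε.trans_le hu)
  have n2 : u' ≠ 0 := norm_pos_iff.1 (hε.trans_le hu')
  have n3 : v ≠ 0 := norm_pos_iff.1 (hε.trans_le hv)
  have n4 : v' ≠ 0 := norm_pos_iff.1 (hε.trans_le hv')
  have hs0 : 0 ≤ s := (norm_nonneg _).trans hs
  have e : (u' * v')⁻¹ - (u * v)⁻¹ = -((u' - u) / (u * u' * v') + (v' - v) / (u * v * v')) := by
    field_simp
    ring
  have bound : ∀ a b c d : ℂ, ε ≤ ‖b‖ → ε ≤ ‖c‖ → ε ≤ ‖d‖ → ‖a‖ ≤ s →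
      ‖a / (b * c * d)‖ ≤ s / ε ^ 3 := by
    intro a b c d hb hc hd ha
    rw [norm_div, norm_mul, norm_mul]
    refine div_le_div₀ hs0 ha (by positivity) ?_
    calc ε ^ 3 = ε * ε * ε := by ring
      _ ≤ _ := by gcongr
  rw [e, norm_neg]
  refine (norm_add_le _ _).trans ?_
  have := bound _ u u' v' hu hu' hv' hs
  have := bound _ u v v' hu hv hv' ht
  have : 2 * s / ε ^ 3 = s / ε ^ 3 + s / ε ^ 3 := by ring
  linarith

lemma exists_uniform_majorant_kernelStep_sub {b l : ℝ} (hΛ : ∀ n, 0 ≤ Λ n) (hM : ∀ n, Λ n ≤ M)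
    (hR : ∀ n, |β n| ≤ R) (hε : 0 < ε) (hβ : Tendsto β atTop (𝓝 b)) (hl : Tendsto Λ atTop (𝓝 l)) :
    ∃ m : ℕ → ℝ, Tendsto m atTop (𝓝 0) ∧ ∀ κ z : ℂ, ε ≤ |κ.im| → ε ≤ |z.im| → ∀ n,
      ‖kernelStep β Λ κ z (n + 1) - kernelStep β Λ κ z n‖ ≤ m n := by
  obtain ⟨m, hm, hmaj⟩ := exists_uniform_majorant_jacobiRatio_sub hΛ hM hR hε hβ hl
  refine ⟨fun n => |Λ (n + 1) - Λ n| / ε ^ 2 + M * (2 * m n / ε ^ 3), ?_, ?_⟩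
  · have l1 := (tendsto_add_atTop_iff_nat 1).2 hl
    have := ((l1.sub hl).abs.div_const (ε ^ 2)).add
      (((hm.const_mul 2).div_const (ε ^ 3)).const_mul M)
    simpa using this
  intro κ z hκ hz n
  have hz' : z.im ≠ 0 := abs_pos.1 (hε.trans_le hz)
  have hκ' : κ.im ≠ 0 := abs_pos.1 (hε.trans_le hκ)
  have hrz := fun k => hz.trans (abs_im_le_norm_jacobiRatio (β := β) hΛ hz' k)
  have hrκ := fun k => hκ.trans (abs_im_le_norm_jacobiRatio (β := β) hΛ hκ' k)
  have e : kernelStep β Λ κ z (n + 1) - kernelStep β Λ κ z n =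
      ((Λ (n + 1) - Λ n : ℝ) : ℂ) / (jacobiRatio β Λ z (n + 1) * jacobiRatio β Λ κ (n + 1)) +
      Λ n * ((jacobiRatio β Λ z (n + 1) * jacobiRatio β Λ κ (n + 1))⁻¹ -
        (jacobiRatio β Λ z n * jacobiRatio β Λ κ n)⁻¹) := by
    rw [kernelStep, kernelStep]
    push_cast
    ring
  rw [e]
  refine (norm_add_le _ _).trans (add_le_add ?_ ?_)
  · rw [norm_div, norm_mul, Complex.norm_real, Real.norm_eq_abs]
    have : ε ^ 2 ≤ ‖jacobiRatio β Λ z (n + 1)‖ * ‖jacobiRatio β Λ κ (n + 1)‖ := by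
      rw [sq]; exact mul_le_mul (hrz _) (hrκ _) hε.le (norm_nonneg _)
    gcongr
  · rw [norm_mul, Complex.norm_real, Real.norm_of_nonneg (hΛ n)]
    exact mul_le_mul (hM n) (norm_inv_mul_sub_inv_mul_le hε (hrz n) (hrz _) (hrκ n) (hrκ _)
      (hmaj z hz n) (hmaj κ hκ n)) (norm_nonneg _) ((hΛ 0).trans (hM 0))

lemma exists_uniform_majorant_kernelRatio_sub {b l : ℝ} (hΛ : ∀ n, 0 ≤ Λ n) (hM : ∀ n, Λ n ≤ M)
    (hR : ∀ n, |β n| ≤ R) (hε : 0 < ε) (hβ : Tendsto β atTop (𝓝 b)) (hl : Tendsto Λ atTop (𝓝 l)) :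
    ∃ m : ℕ → ℝ, Tendsto m atTop (𝓝 0) ∧ ∀ κ z : ℂ, ε ≤ |κ.im| → ε ≤ |z.im| → ∀ n,
      ‖kernelRatio β Λ κ z (n + 1) - kernelRatio β Λ κ z n‖ ≤ m n := by
  have hM0 : 0 ≤ M := (hΛ 0).trans (hM 0)
  set B := 1 + M / ε ^ 2 with hBdef
  have hB1 : 1 ≤ B := by
    have : 0 ≤ M / ε ^ 2 := by positivity
    linarith
  have hθ0 : 0 ≤ 1 - 1 / B := by
    have := (div_le_one (by linarith)).2 hB1
    linarith
  have hθ1 : 1 - 1 / B < 1 := by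
    have : 0 < 1 / B := by positivity
    linarith
  obtain ⟨m', hm', hmaj'⟩ := exists_uniform_majorant_kernelStep_sub hΛ hM hR hε hβ hl
  have hηlim : Tendsto (fun n => m' n * B) atTop (𝓝 0) := by simpa using hm'.mul_const B
  obtain ⟨m, hm, hmaj⟩ :=
    exists_majorant_of_weighted_contraction (B := B) (C := B + B) hθ0 hθ1 hηlim
  refine ⟨m, hm, fun κ z hκ hz => ?_⟩
  have hz' : z.im ≠ 0 := abs_pos.1 (hε.trans_le hz)
  have hκ' : κ.im ≠ 0 := abs_pos.1 (hε.trans_le hκ)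
  have hT1 := one_le_jacobiHeight (β := β) hΛ hz'
  have hTB := jacobiHeight_le (β := β) hΛ hM hε hz
  have hU1 := one_le_jacobiHeight (β := β) hΛ hκ'
  have hUB := jacobiHeight_le (β := β) hΛ hM hε hκ
  have hS : ∀ n, ‖kernelRatio β Λ κ z n‖ ≤ B := fun n =>
    (norm_kernelRatio_le hΛ hz' hκ' n).trans (sqrt_mul_sqrt_le (hTB n) (hUB n) (by linarith))
  refine hmaj _ (fun n => stepFactor β Λ z (n + 1) * stepFactor β Λ κ (n + 1))
    (fun n => √(jacobiHeight β Λ z (n + 1)) * √(jacobiHeight β Λ κ (n + 1)))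
    (fun n => norm_nonneg _) ((norm_sub_le _ _).trans (add_le_add (hS _) (hS _)))
    (fun n => one_le_sqrt_mul_sqrt (hT1 _) (hU1 _))
    (fun n => sqrt_mul_sqrt_le (hTB _) (hUB _) (by linarith))
    (fun n => mul_mul_sqrt_mul_sqrt_le hθ0 (stepFactor_nonneg _)
      (stepFactor_mul_sqrt_height_le hΛ hz' hTB _) (stepFactor_mul_sqrt_height_le hΛ hκ' hUB _))
    (fun n => ?_)
  have e : kernelRatio β Λ κ z (n + 2) - kernelRatio β Λ κ z (n + 1) =
      kernelStep β Λ κ z (n + 1) * (kernelRatio β Λ κ z (n + 1) - kernelRatio β Λ κ z n) +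
      (kernelStep β Λ κ z (n + 1) - kernelStep β Λ κ z n) * kernelRatio β Λ κ z n := by
    have e1 : kernelRatio β Λ κ z (n + 2) =
      1 + kernelStep β Λ κ z (n + 1) * kernelRatio β Λ κ z (n + 1) := rfl
    have e2 : kernelRatio β Λ κ z (n + 1) =
      1 + kernelStep β Λ κ z n * kernelRatio β Λ κ z n := rfl
    linear_combination e1 - e2
  rw [e]
  refine (norm_add_le _ _).trans ?_
  rw [norm_mul, norm_kernelStep hΛ, norm_mul]
  gcongr
  · exact (norm_nonneg _).trans (hmaj' κ z hκ hz n)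
  · exact hmaj' κ z hκ hz n
  · exact hS n

lemma exists_forall_kernelRatio_ne_zero {b l : ℝ} (hΛ : ∀ n, 0 ≤ Λ n) (hε : 0 < ε)
    (hβ : Tendsto β atTop (𝓝 b)) (hl : Tendsto Λ atTop (𝓝 l)) :
    ∃ N, ∀ n, N ≤ n → ∀ κ z : ℂ, ε ≤ |κ.im| → ε ≤ |z.im| → kernelRatio β Λ κ z n ≠ 0 := by
  obtain ⟨M, hM⟩ := hl.bddAbove_range
  replace hM : ∀ n, Λ n ≤ M := fun n => hM ⟨n, rfl⟩
  obtain ⟨R, hR⟩ := hβ.abs.bddAbove_range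
  replace hR : ∀ n, |β n| ≤ R := fun n => hR ⟨n, rfl⟩
  have hM0 : 0 ≤ M := (hΛ 0).trans (hM 0)
  obtain ⟨m, hm, hmaj⟩ := exists_uniform_majorant_kernelRatio_sub hΛ hM hR hε hβ hl
  have hlim : Tendsto (fun n => M / ε / ε * m n) atTop (𝓝 0) := by
    simpa using hm.const_mul (M / ε / ε)
  obtain ⟨N, hN⟩ := Filter.eventually_atTop.1 (hlim.eventually_lt_const one_pos)
  refine ⟨N + 1, fun n hn κ z hκ hz h0 => ?_⟩
  obtain ⟨n, rfl⟩ : ∃ k, n = k + 1 := ⟨n - 1, by omega⟩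
  have h1 := hmaj κ z hκ hz n
  rw [h0, zero_sub, norm_neg] at h1
  have h2 : ‖kernelStep β Λ κ z n‖ ≤ M / ε / ε := by
    have hκ' : κ.im ≠ 0 := abs_pos.1 (hε.trans_le hκ)
    rw [kernelStep, ← div_div, norm_div]
    exact div_le_div₀ (by positivity) (norm_div_jacobiRatio_le hΛ hM hε hz n n) hε
      (hκ.trans (abs_im_le_norm_jacobiRatio hΛ hκ' n))
  have h3 : kernelStep β Λ κ z n * kernelRatio β Λ κ z n = -1 := by
    rw [kernelRatio] at h0
    linear_combination h0
  have h4 : ‖kernelStep β Λ κ z n * kernelRatio β Λ κ z n‖ ≤ M / ε / ε * m n := by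
    rw [norm_mul]
    exact mul_le_mul h2 h1 (norm_nonneg _) (by positivity)
  rw [h3, norm_neg, norm_one] at h4
  linarith [hN n (by omega)]

end Uniform

/-! ### Recurrence coefficients of a positive-definite functional -/

/-- A complex polynomial with real coefficients. -/
def IsRealPoly (p : ℂ[X]) : Prop := ∃ q : ℝ[X], p = q.map Complex.ofRealHom

namespace IsRealPoly

variable {p q : ℂ[X]}

lemma mul (hp : IsRealPoly p) (hq : IsRealPoly q) : IsRealPoly (p * q) := by
  obtain ⟨p, rfl⟩ := hp
  obtain ⟨q, rfl⟩ := hq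
  exact ⟨p * q, by simp⟩

lemma add (hp : IsRealPoly p) (hq : IsRealPoly q) : IsRealPoly (p + q) := by
  obtain ⟨p, rfl⟩ := hp
  obtain ⟨q, rfl⟩ := hq
  exact ⟨p + q, by simp⟩

lemma sub (hp : IsRealPoly p) (hq : IsRealPoly q) : IsRealPoly (p - q) := by
  obtain ⟨p, rfl⟩ := hp
  obtain ⟨q, rfl⟩ := hq
  exact ⟨p - q, by simp⟩

lemma X : IsRealPoly (X : ℂ[X]) := ⟨Polynomial.X, by simp⟩

lemma one : IsRealPoly (1 : ℂ[X]) := ⟨1, by simp⟩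

lemma C {x : ℂ} (hx : x.im = 0) : IsRealPoly (C x) :=
  ⟨Polynomial.C x.re, by simp [Complex.ext_iff, hx]⟩

end IsRealPoly

section Functional

variable {L : ℂ[X] →ₗ[ℂ] ℂ} {P : ℕ → ℂ[X]} {b l : ℕ → ℂ}

lemma IsPositiveDefinite.apply_sq_pos (hL : IsPositiveDefinite L) {p : ℂ[X]} (hp : IsRealPoly p)
    (h0 : p ≠ 0) : 0 < L (p ^ 2) := by
  obtain ⟨q, rfl⟩ := hp
  refine hL _ (pow_ne_zero 2 h0) fun x => ?_
  have h : (q.map Complex.ofRealHom).eval (x : ℂ) = ((q.eval x : ℝ) : ℂ) := by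
    have := Polynomial.eval_map_apply (p := q) Complex.ofRealHom x
    simpa using this
  rw [eval_pow, h, ← Complex.ofReal_pow]
  exact Complex.zero_le_real.2 (sq_nonneg _)

lemma IsPositiveDefinite.im_apply_eq_zero (hL : IsPositiveDefinite L) {p : ℂ[X]}
    (hp : IsRealPoly p) : (L p).im = 0 := by
  have hsq : ∀ q : ℂ[X], IsRealPoly q → (L (q ^ 2)).im = 0 := by
    intro q hq
    by_cases h : q = 0
    · simp [h]
    · exact (Complex.pos_iff.1 (hL.apply_sq_pos hq h)).2.symm
  -- A real polynomial is a difference of squares: `4 p = (p + 1)² - (p - 1)²`.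
  have h4 : (4 : ℂ) • p = (p + 1) ^ 2 - (p - 1) ^ 2 := by
    rw [Polynomial.smul_eq_C_mul, map_ofNat]
    ring
  have h5 := congrArg (fun x => (L x).im) h4
  simp only [map_smul, map_sub, Complex.sub_im, hsq _ (hp.add .one), hsq _ (hp.sub .one),
    smul_eq_mul, Complex.mul_im] at h5
  norm_num at h5
  exact h5

lemma IsMonicOPS.ne_zero (hP : IsMonicOPS L P) (n : ℕ) : P n ≠ 0 := (hP.monic n).ne_zero

lemma apply_C_mul (x : ℂ) (p : ℂ[X]) : L (C x * p) = x * L p := by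
  rw [← Polynomial.smul_eq_C_mul, map_smul, smul_eq_mul]

/-- The reality of `b (n + 1)`: `b (n + 1) = L (X * P n²) / L (P n²)`. -/
lemma im_diag_eq_zero (hL : IsPositiveDefinite L) (hP : IsMonicOPS L P)
    (hrec : IsRecurrenceCoeffs P b l) {n : ℕ} (hn : IsRealPoly (P n)) : (b (n + 1)).im = 0 := by
  have key : L (X * P n * P n) = b (n + 1) * L (P n ^ 2) := by
    cases n with
    | zero =>
      have h := hP.orthogonal 1 0 one_ne_zero
      rw [hrec.one, sub_mul, map_sub, apply_C_mul, hrec.zero, sub_eq_zero] at h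
      simpa [hrec.zero] using h
    | succ n =>
      rw [hrec.rec_eq (n + 1) (by omega), add_mul, add_mul, map_add, map_add, mul_assoc, mul_assoc,
        apply_C_mul, apply_C_mul, hP.orthogonal (n + 1 + 1) (n + 1) (by omega),
        hP.orthogonal (n + 1 - 1) (n + 1) (by omega), sq]
      ring
  have hpos := Complex.pos_iff.1 (hL.apply_sq_pos hn (hP.ne_zero n))
  have him := hL.im_apply_eq_zero ((IsRealPoly.X.mul hn).mul hn)
  rw [key, Complex.mul_im, ← hpos.2, mul_zero, zero_add] at him
  exact (mul_eq_zero.1 him).resolve_right hpos.1.ne'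

/-- The positivity of `l (n + 2)`: `l (n + 2) = L (P (n + 1)²) / L (P n²)`. -/
lemma offDiag_pos (hL : IsPositiveDefinite L) (hP : IsMonicOPS L P)
    (hrec : IsRecurrenceCoeffs P b l) {n : ℕ} (hn : IsRealPoly (P n))
    (hn1 : IsRealPoly (P (n + 1))) : 0 < l (n + 2) := by
  have h1 : L (X * P (n + 1) * P n) = l (n + 2) * L (P n ^ 2) := by
    rw [hrec.rec_eq (n + 1) (by omega), add_mul, add_mul, map_add, map_add, mul_assoc, mul_assoc,
      apply_C_mul, apply_C_mul, hP.orthogonal (n + 1 + 1) n (by omega),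
      hP.orthogonal (n + 1) n (by omega), sq]
    simp
  have h2 : L (X * P n * P (n + 1)) = L (P (n + 1) ^ 2) := by
    cases n with
    | zero =>
      have : X * P 0 * P 1 = P 1 ^ 2 + C (b 1) * (P 0 * P 1) := by
        rw [hrec.zero, hrec.one]; ring
      rw [this, map_add, apply_C_mul, hP.orthogonal _ _ (by omega), mul_zero, add_zero]
    | succ n =>
      rw [hrec.rec_eq (n + 1) (by omega), add_mul, add_mul, map_add, map_add, mul_assoc, mul_assoc,
        apply_C_mul, apply_C_mul, hP.orthogonal (n + 1) (n + 1 + 1) (by omega),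
        hP.orthogonal (n + 1 - 1) (n + 1 + 1) (by omega), sq]
      simp
  have h3 : l (n + 2) * L (P n ^ 2) = L (P (n + 1) ^ 2) := by
    rw [← h1, ← h2]
    congr 1
    ring
  have p0 := hL.apply_sq_pos hn (hP.ne_zero n)
  have p1 := hL.apply_sq_pos hn1 (hP.ne_zero (n + 1))
  rw [← h3] at p1
  exact pos_of_mul_pos_left p1 p0.le

lemma isRealPoly_of_isMonicOPS (hL : IsPositiveDefinite L) (hP : IsMonicOPS L P)
    (hrec : IsRecurrenceCoeffs P b l) (n : ℕ) : IsRealPoly (P n) := by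
  have h : IsRealPoly (P n) ∧ IsRealPoly (P (n + 1)) := by
    induction n with
    | zero =>
      have h0 : IsRealPoly (P 0) := hrec.zero ▸ .one
      refine ⟨h0, ?_⟩
      rw [zero_add, hrec.one]
      exact IsRealPoly.X.sub (.C (im_diag_eq_zero hL hP hrec h0))
    | succ n ih =>
      refine ⟨ih.2, ?_⟩
      have e : P (n + 1 + 1) = X * P (n + 1) - C (b (n + 2)) * P (n + 1) - C (l (n + 2)) * P n := by
        have := hrec.rec_eq (n + 1) (by omega)
        rw [Nat.add_sub_cancel] at this
        rw [this]
        ring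
      rw [e]
      have hl := (Complex.pos_iff.1 (offDiag_pos hL hP hrec ih.1 ih.2)).2.symm
      exact ((IsRealPoly.X.mul ih.2).sub ((IsRealPoly.C (im_diag_eq_zero hL hP hrec ih.2)).mul
        ih.2)).sub ((IsRealPoly.C hl).mul ih.1)
  exact h.1

end Functional

/-! ### Kernel polynomials through the ratio recursion -/

section Kernel

variable {P : ℕ → ℂ[X]} {β Λ : ℕ → ℝ}

lemma eval_ne_zero_and_eval_succ {z : ℂ} (hΛ : ∀ n, 0 ≤ Λ n) (h0 : P 0 = 1)
    (h1 : P 1 = X - C (β 0 : ℂ))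
    (hrec : ∀ n, P (n + 2) = (X - C (β (n + 1) : ℂ)) * P (n + 1) - C (Λ n : ℂ) * P n)
    (hz : z.im ≠ 0) (n : ℕ) :
    (P n).eval z ≠ 0 ∧ (P (n + 1)).eval z = jacobiRatio β Λ z n * (P n).eval z := by
  induction n with
  | zero => simp [h0, h1, jacobiRatio]
  | succ n ih =>
    have hr := jacobiRatio_ne_zero (β := β) hΛ hz n
    have hne : (P (n + 1)).eval z ≠ 0 := by
      rw [ih.2]
      exact mul_ne_zero hr ih.1
    refine ⟨hne, ?_⟩
    rw [hrec n, jacobiRatio, eval_sub, eval_mul, eval_mul, eval_sub, eval_X, eval_C, eval_C, ih.2]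
    field_simp

/-- The kernel polynomials satisfy a first-order recursion. Cancelling the factor `X - C κ` at the
level of polynomials covers the point `κ` itself, where a zero of the kernel polynomial is not
visible from the values of `P n`. -/
lemma kernelPoly_succ {κ : ℂ} (hΛ : ∀ n, 0 ≤ Λ n) (h0 : P 0 = 1) (h1 : P 1 = X - C (β 0 : ℂ))
    (hrec : ∀ n, P (n + 2) = (X - C (β (n + 1) : ℂ)) * P (n + 1) - C (Λ n : ℂ) * P n)
    (hκ : κ.im ≠ 0) (n : ℕ) :
    kernelPoly P κ (n + 1) =
      P (n + 1) + C (Λ n / jacobiRatio β Λ κ n) * kernelPoly P κ n := by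
  have hev := eval_ne_zero_and_eval_succ hΛ h0 h1 hrec hκ
  have hquot : ∀ k, (P (k + 1)).eval κ / (P k).eval κ = jacobiRatio β Λ κ k := fun k => by
    rw [(hev k).2, mul_div_cancel_right₀ _ (hev k).1]
  have hr := jacobiRatio_ne_zero (β := β) hΛ hκ n
  refine mul_left_cancel₀ (X_sub_C_ne_zero κ) ?_
  have e0 := X_sub_C_mul_kernelPoly P κ n (hev n).1
  have e1 := X_sub_C_mul_kernelPoly P κ (n + 1) (hev (n + 1)).1
  rw [hquot] at e0 e1
  have ec : C (Λ n / jacobiRatio β Λ κ n) * C (jacobiRatio β Λ κ n) = C (Λ n : ℂ) := by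
    rw [← C_mul, div_mul_cancel₀ _ hr]
  have er : C (jacobiRatio β Λ κ (n + 1)) =
      C κ - C (β (n + 1) : ℂ) - C (Λ n / jacobiRatio β Λ κ n) := by
    rw [jacobiRatio, C_sub, C_sub]
  rw [hrec n, er] at e1
  linear_combination e1 - C (Λ n / jacobiRatio β Λ κ n) * e0 + P n * ec

lemma eval_kernelPoly_eq {κ z : ℂ} (hΛ : ∀ n, 0 ≤ Λ n) (h0 : P 0 = 1) (h1 : P 1 = X - C (β 0 : ℂ))
    (hrec : ∀ n, P (n + 2) = (X - C (β (n + 1) : ℂ)) * P (n + 1) - C (Λ n : ℂ) * P n)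
    (hκ : κ.im ≠ 0) (hz : z.im ≠ 0) (n : ℕ) :
    (kernelPoly P κ n).eval z = kernelRatio β Λ κ z n * (P n).eval z := by
  induction n with
  | zero =>
    have h : kernelPoly P κ 0 = 1 := by
      refine mul_left_cancel₀ (X_sub_C_ne_zero κ) ?_
      rw [X_sub_C_mul_kernelPoly P κ 0 (by simp [h0])]
      simp [h0, h1]
    simp [h, h0, kernelRatio]
  | succ n ih =>
    have hr := jacobiRatio_ne_zero (β := β) hΛ hz n
    have hr' := jacobiRatio_ne_zero (β := β) hΛ hκ n
    rw [kernelPoly_succ hΛ h0 h1 hrec hκ, eval_add, eval_mul, eval_C, ih,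
      (eval_ne_zero_and_eval_succ hΛ h0 h1 hrec hz n).2, kernelRatio, kernelStep]
    field_simp

end Kernel

theorem mainTheorem8 (L : ℂ[X] →ₗ[ℂ] ℂ) (hL : IsPositiveDefinite L)
    (P : ℕ → ℂ[X]) (hP : IsMonicOPS L P) (a c : ℝ) (hN : InNevaiClass P a c)
    (κ : ℂ) (hκ : κ.im ≠ 0) :
    ∀ ε : ℝ, 0 < ε → ∃ N : ℕ, ∀ n : ℕ, N ≤ n →
      ∀ z : ℂ, (kernelPoly P κ n).IsRoot z → |z.im| < ε := by
  intro ε hε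
  obtain ⟨-, b, l, hrec, hb, hl⟩ := hN
  have hreal := isRealPoly_of_isMonicOPS hL hP hrec
  set β : ℕ → ℝ := fun n => (b (n + 1)).re with hβdef
  set Λ : ℕ → ℝ := fun n => (l (n + 2)).re with hΛdef
  have hβ : ∀ n, b (n + 1) = (β n : ℂ) := fun n =>
    Complex.ext rfl (im_diag_eq_zero hL hP hrec (hreal n))
  have hlpos := fun n => Complex.pos_iff.1 (offDiag_pos hL hP hrec (hreal n) (hreal (n + 1)))
  have hΛ : ∀ n, l (n + 2) = (Λ n : ℂ) := fun n => Complex.ext rfl (hlpos n).2.symm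
  have hΛ0 : ∀ n, 0 ≤ Λ n := fun n => (hlpos n).1.le
  have hβlim : Tendsto β atTop (𝓝 c) :=
    (Complex.continuous_re.tendsto _).comp ((tendsto_add_atTop_iff_nat 1).2 hb)
  have hΛlim : Tendsto Λ atTop (𝓝 a) :=
    (Complex.continuous_re.tendsto _).comp ((tendsto_add_atTop_iff_nat 2).2 hl)
  have h1 : P 1 = X - C (β 0 : ℂ) := by rw [hrec.one, ← hβ]
  have hrec' : ∀ n, P (n + 2) = (X - C (β (n + 1) : ℂ)) * P (n + 1) - C (Λ n : ℂ) * P n := by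
    intro n
    have h := hrec.rec_eq (n + 1) (by omega)
    rw [Nat.add_sub_cancel, hβ (n + 1), hΛ n] at h
    linear_combination -h
  obtain ⟨N, hN⟩ := exists_forall_kernelRatio_ne_zero hΛ0
    (lt_min hε (abs_pos.2 hκ)) hβlim hΛlim
  refine ⟨N, fun n hn z hroot => ?_⟩
  by_contra! hz
  have hz' : z.im ≠ 0 := abs_pos.1 (hε.trans_le hz)
  rw [IsRoot.def, eval_kernelPoly_eq hΛ0 hrec.zero h1 hrec' hκ hz'] at hroot
  exact (mul_ne_zero (hN n hn κ z (min_le_right _ _) ((min_le_left _ _).trans hz))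
    (eval_ne_zero_and_eval_succ hΛ0 hrec.zero h1 hrec' hz' n).1) hroot
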